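/- **Theorem 3.4.** Work in a nonstandard universe that satisfies the transfer principle and countable saturation (every countable family of internal sets with the finite intersection property has nonempty intersection). Write $x\approx y$ if $|x-y|$ is less than every standard positive real, and let $\mathsf{st}$ be the standard part map. Let $\Omega$ be an internal set. An *internal algebra* on $\Omega$ is an internal set of internal subsets of $\Omega$ that contains $\Omega$ and is closed under complements in $\Omega$ and under unions of two sets. An *internal almost probability measure* on an internal algebra $\mathcal A$ on $\Omega$ is an internal mapping $P:\mathcal A\to{}^*[0,1]$ such that $P(\emptyset)=0$, $P(\Omega)=1$, and $P(A\cup B)\approx P(A)+P(B)$ for all disjoint $A,B\in\mathcal A$; then $(\Omega,\mathcal A,P)$ is called an *internal almost probability space*. For such a space let $L_P(\mathcal A)$ be the collection of all (not necessarily internal) sets $B\subset\Omega$ with $$\sup\{\mathsf{st}(P(A)) : A\in\mathcal A,\ A\subset B\}=\inf\{\mathsf{st}(P(C)) : C\in\mathcal A,\ B\subset C\},$$ and for $B\in L_P(\mathcal A)$ let $L(P)(B)$ be this common value. If $(\Omega,\mathcal F,\mu)$ and $(\Omega,\mathcal G,P)$ are internal almost probability spaces, $(\Omega,\mathcal F,\mu)$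 *Loeb extends* $(\Omega,\mathcal G,P)$ if $L_P(\mathcal G)\subset L_\mu(\mathcal F)$ and $L(\mu)(B)=L(P)(B)$ for every $B\in L_P(\mathcal G)$. Let $(\Omega,\mathcal F,\mu)$ be an internal almost probability space and let $\mathcal G$ be an internal algebra on $\Omega$. Then there is an internal almost probability measure $P$ on $\mathcal G$ such that $(\Omega,\mathcal F,\mu)$ Loeb extends $(\Omega,\mathcal G,P)$ if and only if $\mathcal G\subset L_\mu(\mathcal F)$. -/

import Mathlib

universe u v

/-- The finite types over two base sorts: individuals and real numbers. -/
inductive Ty : Type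
  | ind : Ty
  | real : Ty
  | prod : Ty → Ty → Ty
  | pow : Ty → Ty

/-- The standard objects of each type, over an arbitrary set `U` of individuals: `pow` is the full
power set and `prod` the full cartesian product. -/
@[reducible]
def Ty.Std (U : Type u) : Ty → Type u
  | .ind => U
  | .real => ULift.{u} ℝ
  | .prod σ τ => Ty.Std U σ × Ty.Std U τ
  | .pow τ => Set (Ty.Std U τ)

/-- De Bruijn variables of type `τ` in a typed context. -/
inductive Var : List Ty → Ty → Type
  | zero {Γ : List Ty} {τ : Ty} : Var (τ :: Γ) τ
  | succ {Γ : List Ty} {σ τ : Ty} : Var Γ τ → Var (σ :: Γ) τ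

/-- Terms: variables, a name for every standard object of every type, ordered pairs. -/
inductive Tm (U : Type u) : List Ty → Ty → Type u
  | var {Γ : List Ty} {τ : Ty} : Var Γ τ → Tm U Γ τ
  | const {Γ : List Ty} {τ : Ty} : Ty.Std U τ → Tm U Γ τ
  | pair {Γ : List Ty} {σ τ : Ty} : Tm U Γ σ → Tm U Γ τ → Tm U Γ (.prod σ τ)

/-- Formulas of the typed language of set theory with names for all standard objects. -/
inductive Fm (U : Type u) : List Ty → Type u
  | eq {Γ : List Ty} {τ : Ty} : Tm U Γ τ → Tm U Γ τ → Fm U Γ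
  | mem {Γ : List Ty} {τ : Ty} : Tm U Γ τ → Tm U Γ (.pow τ) → Fm U Γ
  | neg {Γ : List Ty} : Fm U Γ → Fm U Γ
  | and {Γ : List Ty} : Fm U Γ → Fm U Γ → Fm U Γ
  | or {Γ : List Ty} : Fm U Γ → Fm U Γ → Fm U Γ
  | imp {Γ : List Ty} : Fm U Γ → Fm U Γ → Fm U Γ
  | all {Γ : List Ty} (τ : Ty) : Fm U (τ :: Γ) → Fm U Γ
  | ex {Γ : List Ty} (τ : Ty) : Fm U (τ :: Γ) → Fm U Γ

/-- A structure for the typed language: a domain for each type, a membership relation and a pairing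
at each type, and an interpretation of the names of standard objects. -/
structure TypedStr (U : Type u) where
  Obj : Ty → Type v
  mem : {τ : Ty} → Obj τ → Obj (.pow τ) → Prop
  pair : {σ τ : Ty} → Obj σ → Obj τ → Obj (.prod σ τ)
  star : (τ : Ty) → Ty.Std U τ → Obj τ

/-- The standard structure: true objects, true membership, true pairs. -/
def standardStr (U : Type u) : TypedStr.{u, u} U where
  Obj := Ty.Std U
  mem := fun {τ} x (A : Set (Ty.Std U τ)) => x ∈ A
  pair := fun x y => (x, y)
  star := fun _ a => a

namespace TypedStr

variable {U : Type u}

/-- Assignments of objects to the variables of a context. -/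
abbrev Env (M : TypedStr.{u, v} U) (Γ : List Ty) : Type v :=
  (τ : Ty) → Var Γ τ → M.Obj τ

/-- The assignment to the empty context. -/
def nil (M : TypedStr.{u, v} U) : M.Env [] := fun _ x => nomatch x

/-- Extend an assignment by a value for the variable `Var.zero`. -/
def cons (M : TypedStr.{u, v} U) {Γ : List Ty} {σ : Ty} (a : M.Obj σ) (e : M.Env Γ) :
    M.Env (σ :: Γ)
  | _, .zero => a
  | _, .succ x => e _ x

/-- The value of a term. -/
def eval (M : TypedStr.{u, v} U) : {Γ : List Ty} → {τ : Ty} → Tm U Γ τ → M.Env Γ → M.Obj τ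
  | _, τ, .var x, e => e τ x
  | _, τ, .const a, _ => M.star τ a
  | _, _, .pair s t, e => M.pair (M.eval s e) (M.eval t e)

/-- Tarski's truth definition. -/
def Holds (M : TypedStr.{u, v} U) : {Γ : List Ty} → Fm U Γ → M.Env Γ → Prop
  | _, .eq s t, e => M.eval s e = M.eval t e
  | _, .mem s t, e => M.mem (M.eval s e) (M.eval t e)
  | _, .neg φ, e => ¬ M.Holds φ e
  | _, .and φ ψ, e => M.Holds φ e ∧ M.Holds ψ e
  | _, .or φ ψ, e => M.Holds φ e ∨ M.Holds ψ e
  | _, .imp φ ψ, e => M.Holds φ e → M.Holds ψ e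
  | _, .all τ φ, e => ∀ x : M.Obj τ, M.Holds φ (M.cons x e)
  | _, .ex τ φ, e => ∃ x : M.Obj τ, M.Holds φ (M.cons x e)

/-- The set of elements of an internal set. -/
def ext (M : TypedStr.{u, v} U) {τ : Ty} (A : M.Obj (.pow τ)) : Set (M.Obj τ) :=
  {x | M.mem x A}

end TypedStr

/-- A countably saturated nonstandard universe over the set `U` of individuals. Its objects are the
internal objects; `star` is the embedding of the standard objects. Transfer is required for all
sentences, in which every standard object may be named; quantifiers of type `pow τ` range over
internal sets. Saturation: every countable family of internal sets with the finite intersection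
property has nonempty intersection. -/
structure NonstandardUniverse (U : Type u) extends TypedStr.{u, v} U where
  transfer : ∀ φ : Fm U [],
    (standardStr U).Holds φ (standardStr U).nil ↔ toTypedStr.Holds φ toTypedStr.nil
  saturation : ∀ {τ : Ty} (A : ℕ → Obj (.pow τ)),
    (∀ n : ℕ, (⋂ i ∈ Finset.range n, toTypedStr.ext (A i)).Nonempty) →
      (⋂ i : ℕ, toTypedStr.ext (A i)).Nonempty

namespace NonstandardUniverse

variable {U : Type u} (S : NonstandardUniverse.{u, v} U)

/-- The graph of a standard function is, after `star`, the graph of a function. -/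
theorem existsUnique_starFun {σ τ : Ty} (f : Ty.Std U σ → Ty.Std U τ) (x : S.Obj σ) :
    ∃! y : S.Obj τ,
      S.mem (S.pair x y) (S.star (.pow (.prod σ τ)) {p : Ty.Std U σ × Ty.Std U τ | f p.1 = p.2}) := by
  let g : Ty.Std U (.pow (.prod σ τ)) := {p : Ty.Std U σ × Ty.Std U τ | f p.1 = p.2}
  have h := (S.transfer (.all σ (.ex τ (.and
    (.mem (.pair (.var (.succ .zero)) (.var .zero)) (.const g))
    (.all τ (.imp (.mem (.pair (.var (.succ (.succ .zero))) (.var .zero)) (.const g))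
      (.eq (.var .zero) (.var (.succ .zero))))))))).1
      (by
        simp only [TypedStr.Holds, TypedStr.eval, TypedStr.cons]
        exact fun a => ⟨f a, rfl, fun _ hb => hb.symm⟩)
  simp only [TypedStr.Holds, TypedStr.eval, TypedStr.cons] at h
  exact h x

/-- The nonstandard extension `*f` of a standard function `f`. -/
noncomputable def starFun {σ τ : Ty} (f : Ty.Std U σ → Ty.Std U τ) (x : S.Obj σ) : S.Obj τ :=
  (S.existsUnique_starFun f x).choose

/-- The standard real `r` as a hyperreal. -/
def ofReal (r : ℝ) : S.Obj .real := S.star .real (ULift.up r)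

/-- Addition of hyperreals. -/
noncomputable def add (x y : S.Obj .real) : S.Obj .real :=
  S.starFun (σ := .prod .real .real) (τ := .real)
    (fun p : ULift.{u} ℝ × ULift.{u} ℝ => (ULift.up (p.1.down + p.2.down) : ULift.{u} ℝ))
    (S.pair x y)

/-- The hyperreal distance `|x - y|`. -/
noncomputable def dist (x y : S.Obj .real) : S.Obj .real :=
  S.starFun (σ := .prod .real .real) (τ := .real)
    (fun p : ULift.{u} ℝ × ULift.{u} ℝ => (ULift.up |p.1.down - p.2.down| : ULift.{u} ℝ))
    (S.pair x y)

/-- The strict order of the hyperreals. -/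
def Less (x y : S.Obj .real) : Prop :=
  S.mem (S.pair x y)
    (S.star (.pow (.prod .real .real)) {p : ULift.{u} ℝ × ULift.{u} ℝ | p.1.down < p.2.down})

/-- `x ≈ y`: the distance is below every standard positive real. -/
def Near (x y : S.Obj .real) : Prop :=
  ∀ ε : ℝ, 0 < ε → S.Less (S.dist x y) (S.ofReal ε)

open Classical in
/-- The standard part of a hyperreal (`0` if the hyperreal is not near a standard real). -/
noncomputable def st (x : S.Obj .real) : ℝ :=
  if h : ∃ r : ℝ, S.Near x (S.ofReal r) then h.choose else 0

/-- The internal interval `*[0,1]`. -/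
def unitInterval : S.Obj (.pow .real) :=
  S.star (.pow .real) {x : ULift.{u} ℝ | x.down ∈ Set.Icc (0 : ℝ) 1}

/-- `f` is (the graph of) an internal mapping from the internal set `A` to the internal set `B`. -/
structure IsInternalMap {σ τ : Ty} (A : S.Obj (.pow σ)) (B : S.Obj (.pow τ))
    (f : S.Obj (.pow (.prod σ τ))) : Prop where
  subset_prod : ∀ p ∈ S.ext f, ∃ x ∈ S.ext A, ∃ y ∈ S.ext B, p = S.pair x y
  existsUnique : ∀ x ∈ S.ext A, ∃! y, S.pair x y ∈ S.ext f

open Classical in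
/-- The value at `x` of an internal hyperreal-valued mapping (`0` outside of its domain). -/
noncomputable def value {σ : Ty} (f : S.Obj (.pow (.prod σ .real))) (x : S.Obj σ) : S.Obj .real :=
  if h : ∃ y, S.pair x y ∈ S.ext f then h.choose else S.ofReal 0

/-- `F` is an internal algebra of subsets of the internal set `Ω`. -/
structure IsInternalAlgebra {τ : Ty} (Ω : S.Obj (.pow τ)) (F : S.Obj (.pow (.pow τ))) : Prop where
  subset : ∀ A ∈ S.ext F, S.ext A ⊆ S.ext Ω
  space_mem : Ω ∈ S.ext F
  compl_mem : ∀ A ∈ S.ext F, ∃ B ∈ S.ext F, S.ext B = S.ext Ω \ S.ext A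
  union_mem : ∀ A ∈ S.ext F, ∀ B ∈ S.ext F, ∃ C ∈ S.ext F, S.ext C = S.ext A ∪ S.ext B

/-- `P` is an internal almost probability measure on the internal algebra `F` on `Ω`, that is,
`(Ω, F, P)` is an internal almost probability space. -/
structure IsAlmostProbability {τ : Ty} (Ω : S.Obj (.pow τ)) (F : S.Obj (.pow (.pow τ)))
    (P : S.Obj (.pow (.prod (.pow τ) .real))) : Prop where
  algebra : S.IsInternalAlgebra Ω F
  internal_map : S.IsInternalMap F S.unitInterval P
  empty : ∀ A ∈ S.ext F, S.ext A = ∅ → S.value P A = S.ofReal 0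
  space : S.value P Ω = S.ofReal 1
  union : ∀ A ∈ S.ext F, ∀ B ∈ S.ext F, ∀ C ∈ S.ext F,
    Disjoint (S.ext A) (S.ext B) → S.ext C = S.ext A ∪ S.ext B →
      S.Near (S.value P C) (S.add (S.value P A) (S.value P B))

/-- The supremum of `st (P A)` over the `A ∈ F` contained in `B`. -/
noncomputable def loebInner {τ : Ty} (F : S.Obj (.pow (.pow τ)))
    (P : S.Obj (.pow (.prod (.pow τ) .real))) (B : Set (S.Obj τ)) : ℝ :=
  sSup {r : ℝ | ∃ A ∈ S.ext F, S.ext A ⊆ B ∧ r = S.st (S.value P A)}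

/-- The infimum of `st (P C)` over the `C ∈ F` containing `B`. -/
noncomputable def loebOuter {τ : Ty} (F : S.Obj (.pow (.pow τ)))
    (P : S.Obj (.pow (.prod (.pow τ) .real))) (B : Set (S.Obj τ)) : ℝ :=
  sInf {r : ℝ | ∃ C ∈ S.ext F, B ⊆ S.ext C ∧ r = S.st (S.value P C)}

/-- The Loeb algebra of `(Ω, F, P)`: a collection of external subsets of `Ω`. -/
def loebAlgebra {τ : Ty} (Ω : S.Obj (.pow τ)) (F : S.Obj (.pow (.pow τ)))
    (P : S.Obj (.pow (.prod (.pow τ) .real))) : Set (Set (S.Obj τ)) :=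
  {B | B ⊆ S.ext Ω ∧ S.loebInner F P B = S.loebOuter F P B}

/-- The Loeb measure of a set in the Loeb algebra. -/
noncomputable def loebMeasure {τ : Ty} (F : S.Obj (.pow (.pow τ)))
    (P : S.Obj (.pow (.prod (.pow τ) .real))) (B : Set (S.Obj τ)) : ℝ :=
  S.loebInner F P B

/-- `(Ω, G, ν)` Loeb extends `(Ω, F, μ)`. -/
def LoebExtends {τ : Ty} (Ω : S.Obj (.pow τ))
    (G : S.Obj (.pow (.pow τ))) (ν : S.Obj (.pow (.prod (.pow τ) .real)))
    (F : S.Obj (.pow (.pow τ))) (μ : S.Obj (.pow (.prod (.pow τ) .real))) : Prop :=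
  S.loebAlgebra Ω F μ ⊆ S.loebAlgebra Ω G ν ∧
    ∀ B ∈ S.loebAlgebra Ω F μ, S.loebMeasure G ν B = S.loebMeasure F μ B

end NonstandardUniverse

/-! If `P` exists, every member of `G` lies in the Loeb algebra of `P`, hence in that of `μ`. For
the converse, fix a standard `ε > 0` and relate `A ∈ G` to those `y` in `*[0,1]` that are `ε`-close
to `μ C` and to `μ D` for some `C ⊆ A ⊆ D` in `F`, with `y = μ A` when `A ∈ F` (`Approx`). This
relation is internal, and it is total on `G` because the members of `G` are Loeb measurable.
Transferred choice gives an internal map inside it. The internal maps obtained this way form an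
internal set that shrinks with `ε`, so countable saturation along `ε = 1 / (n + 1)` gives one `P`
that works for every `ε` (`exists_internal_map`). Inner and outer approximations then make `P`
almost additive (`of_approx`) and squeeze the Loeb measures together (`loebExtends_of_approx`).

Standard parts are computed as limits: an internal `x` determines the ultrafilter of standard sets
`A` with `x ∈ *A`, and `st x` is the limit along it. The limit calculus of `ℝ` thus takes the place
of hyperreal arithmetic. -/

open Filter Topology

namespace NonstandardUniverse

variable {U : Type u} (S : NonstandardUniverse.{u, v} U)

local notation "v0" => Tm.var Var.zero
local notation "v1" => Tm.var (Var.succ Var.zero)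
local notation "v2" => Tm.var (Var.succ (Var.succ Var.zero))
local notation "v3" => Tm.var (Var.succ (Var.succ (Var.succ Var.zero)))
local notation "v4" => Tm.var (Var.succ (Var.succ (Var.succ (Var.succ Var.zero))))
local notation "v5" => Tm.var (Var.succ (Var.succ (Var.succ (Var.succ (Var.succ Var.zero)))))

/-! ### Transfer, and the ultrafilter of an internal object -/

/-- Internal sets with the same elements are equal. -/
theorem ext_injective {τ : Ty} {A B : S.Obj (.pow τ)} (h : S.ext A = S.ext B) : A = B := by
  have t := (S.transfer (.all (.pow τ) (.all (.pow τ) (.imp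
    (.all τ (.and (.imp (.mem v0 v2) (.mem v0 v1)) (.imp (.mem v0 v1) (.mem v0 v2))))
    (.eq v1 v0))))).1 (by
      simp only [TypedStr.Holds, TypedStr.eval, TypedStr.cons]
      exact fun a b hab => Set.ext fun x => ⟨(hab x).1, (hab x).2⟩)
  simp only [TypedStr.Holds, TypedStr.eval, TypedStr.cons] at t
  exact t A B fun x => ⟨fun hx => (Set.ext_iff.1 h x).1 hx, fun hx => (Set.ext_iff.1 h x).2 hx⟩

theorem pair_injective {σ τ : Ty} {x x' : S.Obj σ} {y y' : S.Obj τ}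
    (h : S.pair x y = S.pair x' y') : x = x' ∧ y = y' := by
  have t := (S.transfer (.all σ (.all τ (.all σ (.all τ (.imp
    (.eq (.pair v3 v2) (.pair v1 v0)) (.and (.eq v3 v1) (.eq v2 v0)))))))).1 (by
      simp only [TypedStr.Holds, TypedStr.eval, TypedStr.cons]
      exact fun a b c d hab => ⟨congrArg Prod.fst hab, congrArg Prod.snd hab⟩)
  simp only [TypedStr.Holds, TypedStr.eval, TypedStr.cons] at t
  exact t x y x' y' h

theorem mem_star_univ {σ : Ty} (x : S.Obj σ) :
    S.mem x (S.star (.pow σ) (Set.univ : Set (Ty.Std U σ))) := by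
  have t := (S.transfer (.all σ (.mem v0
    (.const (τ := .pow σ) (Set.univ : Set (Ty.Std U σ)))))).1 (by
      simp only [TypedStr.Holds, TypedStr.eval, TypedStr.cons]
      exact fun a => Set.mem_univ a)
  simp only [TypedStr.Holds, TypedStr.eval, TypedStr.cons] at t
  exact t x

theorem mem_star_mono {σ : Ty} {A B : Set (Ty.Std U σ)} (h : A ⊆ B) {x : S.Obj σ}
    (hx : S.mem x (S.star (.pow σ) A)) : S.mem x (S.star (.pow σ) B) := by
  have t := (S.transfer (.all σ (.imp (.mem v0 (.const (τ := .pow σ) A))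
    (.mem v0 (.const (τ := .pow σ) B))))).1 (by
      simp only [TypedStr.Holds, TypedStr.eval, TypedStr.cons]
      exact fun a ha => h ha)
  simp only [TypedStr.Holds, TypedStr.eval, TypedStr.cons] at t
  exact t x hx

theorem mem_star_inter {σ : Ty} {A B : Set (Ty.Std U σ)} {x : S.Obj σ}
    (hA : S.mem x (S.star (.pow σ) A)) (hB : S.mem x (S.star (.pow σ) B)) :
    S.mem x (S.star (.pow σ) (A ∩ B : Set (Ty.Std U σ))) := by
  have t := (S.transfer (.all σ (.imp (.mem v0 (.const (τ := .pow σ) A))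
    (.imp (.mem v0 (.const (τ := .pow σ) B))
      (.mem v0 (.const (τ := .pow σ) (A ∩ B : Set (Ty.Std U σ)))))))).1 (by
      simp only [TypedStr.Holds, TypedStr.eval, TypedStr.cons]
      exact fun a ha hb => ⟨ha, hb⟩)
  simp only [TypedStr.Holds, TypedStr.eval, TypedStr.cons] at t
  exact t x hA hB

theorem mem_star_compl {σ : Ty} (A : Set (Ty.Std U σ)) (x : S.Obj σ) :
    ¬ S.mem x (S.star (.pow σ) (Aᶜ : Set (Ty.Std U σ))) ↔ S.mem x (S.star (.pow σ) A) := by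
  have t := (S.transfer (.all σ (.and
    (.imp (.neg (.mem v0 (.const (τ := .pow σ) (Aᶜ : Set (Ty.Std U σ)))))
      (.mem v0 (.const (τ := .pow σ) A)))
    (.imp (.mem v0 (.const (τ := .pow σ) A))
      (.neg (.mem v0 (.const (τ := .pow σ) (Aᶜ : Set (Ty.Std U σ))))))))).1 (by
      simp only [TypedStr.Holds, TypedStr.eval, TypedStr.cons]
      exact fun a => ⟨fun h => not_not.1 h, fun h h' => h' h⟩)
  simp only [TypedStr.Holds, TypedStr.eval, TypedStr.cons] at t
  exact ⟨(t x).1, (t x).2⟩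

/-- The ultrafilter of the standard sets whose nonstandard extension contains `x`. -/
def ultra {σ : Ty} (x : S.Obj σ) : Ultrafilter (Ty.Std U σ) :=
  Ultrafilter.ofComplNotMemIff
    { sets := {A : Set (Ty.Std U σ) | S.mem x (S.star (.pow σ) A)}
      univ_sets := S.mem_star_univ x
      sets_of_superset := fun hA h => S.mem_star_mono h hA
      inter_sets := fun hA hB => S.mem_star_inter hA hB }
    (fun A => S.mem_star_compl A x)

theorem mem_ultra {σ : Ty} {x : S.Obj σ} {A : Set (Ty.Std U σ)} :
    A ∈ S.ultra x ↔ S.mem x (S.star (.pow σ) A) := Iff.rfl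

theorem ultra_star {σ : Ty} (a : Ty.Std U σ) : S.ultra (S.star σ a) = pure a := by
  refine Ultrafilter.ext fun A => ?_
  rw [mem_ultra, Ultrafilter.mem_pure]
  have t := S.transfer (.mem (.const a) (.const (τ := .pow σ) A))
  simp only [TypedStr.Holds, TypedStr.eval] at t
  exact t.symm

/-- Ultrafilters are maximal, so one inclusion suffices. The ultrafilter of a pair is not determined
by its two marginals, but limits of functions of a single coordinate are. -/
theorem map_fst_ultra_pair {σ τ : Ty} (x : S.Obj σ) (y : S.Obj τ) :
    (S.ultra (S.pair x y)).map Prod.fst = S.ultra x := by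
  refine Ultrafilter.coe_le_coe.1 fun A hA => ?_
  have t := (S.transfer (.all σ (.all τ (.imp (.mem v1 (.const (τ := .pow σ) A))
    (.mem (.pair v1 v0) (.const (τ := .pow (.prod σ τ))
      (Prod.fst ⁻¹' A : Set (Ty.Std U σ × Ty.Std U τ)))))))).1 (by
      simp only [TypedStr.Holds, TypedStr.eval, TypedStr.cons]
      exact fun a b h => h)
  simp only [TypedStr.Holds, TypedStr.eval, TypedStr.cons] at t
  exact t x y hA

theorem map_snd_ultra_pair {σ τ : Ty} (x : S.Obj σ) (y : S.Obj τ) :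
    (S.ultra (S.pair x y)).map Prod.snd = S.ultra y := by
  refine Ultrafilter.coe_le_coe.1 fun A hA => ?_
  have t := (S.transfer (.all σ (.all τ (.imp (.mem v0 (.const (τ := .pow τ) A))
    (.mem (.pair v1 v0) (.const (τ := .pow (.prod σ τ))
      (Prod.snd ⁻¹' A : Set (Ty.Std U σ × Ty.Std U τ)))))))).1 (by
      simp only [TypedStr.Holds, TypedStr.eval, TypedStr.cons]
      exact fun a b h => h)
  simp only [TypedStr.Holds, TypedStr.eval, TypedStr.cons] at t
  exact t x y hA

/-- Lets any limit law for `f` be applied to `*f`. -/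
theorem ultra_starFun {σ τ : Ty} (f : Ty.Std U σ → Ty.Std U τ) (x : S.Obj σ) :
    S.ultra (S.starFun f x) = (S.ultra x).map f := by
  refine (Ultrafilter.coe_le_coe.1 fun A hA => ?_).symm
  have t := (S.transfer (.all σ (.all τ (.imp
    (.mem (.pair v1 v0) (.const (τ := .pow (.prod σ τ))
      {p : Ty.Std U σ × Ty.Std U τ | f p.1 = p.2}))
    (.imp (.mem v0 (.const (τ := .pow τ) A))
      (.mem v1 (.const (τ := .pow σ) (f ⁻¹' A : Set (Ty.Std U σ))))))))).1 (by
      simp only [TypedStr.Holds, TypedStr.eval, TypedStr.cons]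
      rintro a b h hb
      change f a = b at h
      subst h
      exact hb)
  simp only [TypedStr.Holds, TypedStr.eval, TypedStr.cons] at t
  exact t x _ (S.existsUnique_starFun f x).choose_spec.1 hA

/-! ### Standard parts as limits along ultrafilters -/

/-- `x` is nearly standard with standard part `r`. -/
def TendsTo (x : S.Obj .real) (r : ℝ) : Prop :=
  Tendsto ULift.down (S.ultra x : Filter (ULift.{u} ℝ)) (𝓝 r)

theorem tendsTo_ofReal (r : ℝ) : S.TendsTo (S.ofReal r) r := by
  rw [TendsTo, ofReal, ultra_star]
  exact tendsto_pure_nhds ULift.down (ULift.up r : ULift.{u} ℝ)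

variable {S}

theorem TendsTo.unique {x : S.Obj .real} {r s : ℝ} (hr : S.TendsTo x r) (hs : S.TendsTo x s) :
    r = s := tendsto_nhds_unique hr hs

theorem TendsTo.fst {x : S.Obj .real} {r : ℝ} (hr : S.TendsTo x r) {τ : Ty} (y : S.Obj τ) :
    Tendsto (fun p : ULift.{u} ℝ × Ty.Std U τ => p.1.down) (S.ultra (S.pair x y)) (𝓝 r) := by
  rw [TendsTo, ← S.map_fst_ultra_pair x y, Ultrafilter.coe_map] at hr
  exact tendsto_map'_iff.1 hr

theorem TendsTo.snd {x : S.Obj .real} {r : ℝ} (hr : S.TendsTo x r) {τ : Ty} (y : S.Obj τ) :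
    Tendsto (fun p : Ty.Std U τ × ULift.{u} ℝ => p.2.down) (S.ultra (S.pair y x)) (𝓝 r) := by
  rw [TendsTo, ← S.map_snd_ultra_pair y x, Ultrafilter.coe_map] at hr
  exact tendsto_map'_iff.1 hr

theorem TendsTo.add {x y : S.Obj .real} {r s : ℝ} (hr : S.TendsTo x r) (hs : S.TendsTo y s) :
    S.TendsTo (S.add x y) (r + s) := by
  rw [TendsTo, NonstandardUniverse.add, ultra_starFun, Ultrafilter.coe_map, tendsto_map'_iff]
  exact (hr.fst y).add (hs.snd x)

variable (S)

theorem near_iff {x y : S.Obj .real} :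
    S.Near x y ↔ ∀ ε : ℝ, 0 < ε →
      {p : ULift.{u} ℝ × ULift.{u} ℝ | |p.1.down - p.2.down| < ε} ∈ S.ultra (S.pair x y) := by
  refine forall₂_congr fun ε _ => ?_
  have h : S.Less (S.dist x y) (S.ofReal ε) ↔
      {z : ULift.{u} ℝ | z.down < ε} ∈ S.ultra (S.dist x y) := by
    have t := (S.transfer (.all .real (.and
      (.imp (.mem (.pair v0 (.const (τ := .real) (ULift.up ε : ULift.{u} ℝ)))
          (.const (τ := .pow (.prod .real .real))
            {p : ULift.{u} ℝ × ULift.{u} ℝ | p.1.down < p.2.down}))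
        (.mem v0 (.const (τ := .pow .real) {z : ULift.{u} ℝ | z.down < ε})))
      (.imp (.mem v0 (.const (τ := .pow .real) {z : ULift.{u} ℝ | z.down < ε}))
        (.mem (.pair v0 (.const (τ := .real) (ULift.up ε : ULift.{u} ℝ)))
          (.const (τ := .pow (.prod .real .real))
            {p : ULift.{u} ℝ × ULift.{u} ℝ | p.1.down < p.2.down})))))).1 (by
        simp only [TypedStr.Holds, TypedStr.eval, TypedStr.cons]
        exact fun a => ⟨fun h => h, fun h => h⟩)
    simp only [TypedStr.Holds, TypedStr.eval, TypedStr.cons] at t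
    exact ⟨(t _).1, (t _).2⟩
  rw [h, dist, ultra_starFun, Ultrafilter.mem_map]
  rfl

/-- Nearness says that the difference of coordinates tends to `0` along the ultrafilter of the pair;
adding or subtracting the limit of `y` passes between the two sides. -/
theorem near_iff_of_tendsTo {x y : S.Obj .real} {s : ℝ} (hs : S.TendsTo y s) :
    S.Near x y ↔ S.TendsTo x s := by
  have hy := hs.snd x
  rw [near_iff, TendsTo, ← S.map_fst_ultra_pair x y, Ultrafilter.coe_map, tendsto_map'_iff]
  have key : (∀ ε : ℝ, 0 < ε →
      {p : ULift.{u} ℝ × ULift.{u} ℝ | |p.1.down - p.2.down| < ε} ∈ S.ultra (S.pair x y)) ↔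
      Tendsto (fun p : ULift.{u} ℝ × ULift.{u} ℝ => p.1.down - p.2.down)
        (S.ultra (S.pair x y)) (𝓝 0) := by
    rw [Metric.tendsto_nhds]
    refine forall₂_congr fun ε _ => ?_
    simp only [Real.dist_eq, sub_zero]
    rfl
  rw [key]
  constructor
  · intro h
    have := h.add hy
    simpa [Function.comp_def] using this
  · intro h
    have := h.sub hy
    simpa [Function.comp_def] using this

/-- The choice made in `st` is immaterial because limits in `ℝ` are unique. -/
theorem st_eq {x : S.Obj .real} {r : ℝ} (h : S.TendsTo x r) : S.st x = r := by
  have hx : ∃ r : ℝ, S.Near x (S.ofReal r) :=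
    ⟨r, (S.near_iff_of_tendsTo (S.tendsTo_ofReal r)).2 h⟩
  rw [st, dif_pos hx]
  exact TendsTo.unique ((S.near_iff_of_tendsTo (S.tendsTo_ofReal _)).1 hx.choose_spec) h

theorem exists_tendsTo {x : S.Obj .real} (hx : x ∈ S.ext S.unitInterval) :
    ∃ r ∈ Set.Icc (0 : ℝ) 1, S.TendsTo x r := by
  -- By definition `hx` says that the ultrafilter pushed forward to `ℝ` contains `[0,1]`, so
  -- compactness gives a limit.
  obtain ⟨r, hr, h⟩ := isCompact_Icc.ultrafilter_le_nhds'
    ((S.ultra x).map (ULift.down : ULift.{u} ℝ → ℝ)) (s := Set.Icc (0 : ℝ) 1) hx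
  exact ⟨r, hr, h⟩

theorem tendsTo_st {x : S.Obj .real} (hx : x ∈ S.ext S.unitInterval) :
    S.TendsTo x (S.st x) := by
  obtain ⟨r, -, h⟩ := S.exists_tendsTo hx
  rwa [S.st_eq h]

theorem st_mem_Icc {x : S.Obj .real} (hx : x ∈ S.ext S.unitInterval) :
    S.st x ∈ Set.Icc (0 : ℝ) 1 := by
  obtain ⟨r, hr, h⟩ := S.exists_tendsTo hx
  rwa [S.st_eq h]

/-- Turns almost additivity into exact additivity of standard parts. The sum may leave `*[0,1]`, but
it is still nearly standard. -/
theorem near_add_iff {x y z : S.Obj .real} (hx : x ∈ S.ext S.unitInterval)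
    (hy : y ∈ S.ext S.unitInterval) (hz : z ∈ S.ext S.unitInterval) :
    S.Near z (S.add x y) ↔ S.st z = S.st x + S.st y := by
  rw [S.near_iff_of_tendsTo ((S.tendsTo_st hx).add (S.tendsTo_st hy))]
  exact ⟨S.st_eq, fun h => h ▸ S.tendsTo_st hz⟩

/-- The standard relation of being at distance less than `ε`. -/
def closeRel (ε : ℝ) : Ty.Std U (.pow (.prod .real .real)) :=
  {p : ULift.{u} ℝ × ULift.{u} ℝ | |p.1.down - p.2.down| < ε}

/-- `x` and `y` are at distance less than the standard real `ε`. -/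
def Close (ε : ℝ) (x y : S.Obj .real) : Prop :=
  S.mem (S.pair x y) (S.star (.pow (.prod .real .real)) (closeRel ε))

variable {S} in
theorem Close.mono {ε δ : ℝ} {x y : S.Obj .real} (h : S.Close ε x y) (hεδ : ε ≤ δ) :
    S.Close δ x y :=
  S.mem_star_mono (fun _ hp => lt_of_lt_of_le hp hεδ) h

theorem tendsto_abs_sub {x y : S.Obj .real} (hx : x ∈ S.ext S.unitInterval)
    (hy : y ∈ S.ext S.unitInterval) :
    Tendsto (fun p : ULift.{u} ℝ × ULift.{u} ℝ => |p.1.down - p.2.down|)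
      (S.ultra (S.pair x y)) (𝓝 |S.st x - S.st y|) :=
  (((S.tendsTo_st hx).fst y).sub ((S.tendsTo_st hy).snd x)).abs

theorem close_of_abs_lt {ε : ℝ} {x y : S.Obj .real} (hx : x ∈ S.ext S.unitInterval)
    (hy : y ∈ S.ext S.unitInterval) (h : |S.st x - S.st y| < ε) : S.Close ε x y :=
  (S.tendsto_abs_sub hx hy).eventually_lt_const h

/-- A strict bound becomes weak in the limit, so this is not an exact converse of `close_of_abs_lt`.
-/
theorem abs_le_of_close {ε : ℝ} {x y : S.Obj .real} (hx : x ∈ S.ext S.unitInterval)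
    (hy : y ∈ S.ext S.unitInterval) (h : S.Close ε x y) : |S.st x - S.st y| ≤ ε := by
  have h' : ∀ᶠ p : ULift.{u} ℝ × ULift.{u} ℝ in (S.ultra (S.pair x y) : Filter _),
      |p.1.down - p.2.down| < ε := h
  exact le_of_tendsto (S.tendsto_abs_sub hx hy) (h'.mono fun _ => le_of_lt)

/-! ### Internal choice and internally definable relations -/

/-- Internal choice: an internal relation that is total on `G` contains the graph of an internal
mapping on `G`. -/
theorem exists_internal_choice {σ τ : Ty} (G : S.Obj (.pow σ)) (R : S.Obj (.pow (.prod σ τ)))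
    (h : ∀ x ∈ S.ext G, ∃ y, S.pair x y ∈ S.ext R) :
    ∃ P : S.Obj (.pow (.prod σ τ)), (∀ p ∈ S.ext P, p ∈ S.ext R) ∧
      (∀ p ∈ S.ext P, ∃ x ∈ S.ext G, ∃ y, p = S.pair x y) ∧
      ∀ x ∈ S.ext G, ∃ y, S.pair x y ∈ S.ext P ∧ ∀ z, S.pair x z ∈ S.ext P → z = y := by
  have t := (S.transfer (.all (.pow σ) (.all (.pow (.prod σ τ)) (.imp
    (.all σ (.imp (.mem v0 v2) (.ex τ (.mem (.pair v1 v0) v2))))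
    (.ex (.pow (.prod σ τ)) (.and
      (.all (.prod σ τ) (.imp (.mem v0 v1) (.mem v0 v2)))
      (.and
        (.all (.prod σ τ) (.imp (.mem v0 v1)
          (.ex σ (.and (.mem v0 v4) (.ex τ (.eq v2 (.pair v1 v0)))))))
        (.all σ (.imp (.mem v0 v3) (.ex τ (.and (.mem (.pair v1 v0) v2)
          (.all τ (.imp (.mem (.pair v2 v0) v3) (.eq v0 v1)))))))))))))).1 (by
      simp only [TypedStr.Holds, TypedStr.eval, TypedStr.cons]
      intro (G : Set (Ty.Std U σ)) (R : Set (Ty.Std U σ × Ty.Std U τ)) h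
      have h' : ∀ x, x ∈ G → ∃ y, (x, y) ∈ R := h
      -- Ordinary choice in the standard universe; transfer makes the resulting graph internal.
      choose f hf using h'
      refine ⟨{p : Ty.Std U σ × Ty.Std U τ | ∃ hx : p.1 ∈ G, f p.1 hx = p.2}, ?_, ?_, ?_⟩
      · rintro ⟨x, y⟩ ⟨hx, hy⟩
        have hfx := hf x hx
        rw [show f x hx = y from hy] at hfx
        exact hfx
      · rintro ⟨x, y⟩ ⟨hx, hy⟩
        exact ⟨x, hx, y, rfl⟩
      · intro x hx
        exact ⟨f x hx, ⟨hx, rfl⟩, fun z ⟨_, hz⟩ => hz.symm⟩)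
  simp only [TypedStr.Holds, TypedStr.eval, TypedStr.cons] at t
  exact t G R h

/-- The internal mappings on `G` with graph inside `R` form an internal set. -/
theorem exists_internal_selections {σ τ : Ty} (G : S.Obj (.pow σ)) (R : S.Obj (.pow (.prod σ τ))) :
    ∃ X : S.Obj (.pow (.pow (.prod σ τ))), ∀ P, P ∈ S.ext X ↔
      (∀ p ∈ S.ext P, p ∈ S.ext R) ∧
      (∀ p ∈ S.ext P, ∃ x ∈ S.ext G, ∃ y, p = S.pair x y) ∧
      ∀ x ∈ S.ext G, ∃ y, S.pair x y ∈ S.ext P ∧ ∀ z, S.pair x z ∈ S.ext P → z = y := by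
  -- Outside its own quantifiers, `φ` reads its variables as `P`, `X`, `R`, `G`, from index `0` up;
  -- `X` does not occur in it.
  let φ : Fm U [.pow (.prod σ τ), .pow (.pow (.prod σ τ)), .pow (.prod σ τ), .pow σ] :=
    .and (.all (.prod σ τ) (.imp (.mem v0 v1) (.mem v0 v3)))
      (.and
        (.all (.prod σ τ) (.imp (.mem v0 v1)
          (.ex σ (.and (.mem v0 v5) (.ex τ (.eq v2 (.pair v1 v0)))))))
        (.all σ (.imp (.mem v0 v4) (.ex τ (.and (.mem (.pair v1 v0) v2)
          (.all τ (.imp (.mem (.pair v2 v0) v3) (.eq v0 v1))))))))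
  have t := (S.transfer (.all (.pow σ) (.all (.pow (.prod σ τ)) (.ex (.pow (.pow (.prod σ τ)))
    (.all (.pow (.prod σ τ)) (.and (.imp (.mem v0 v1) φ) (.imp φ (.mem v0 v1)))))))).1 (by
      simp only [φ, TypedStr.Holds, TypedStr.eval, TypedStr.cons]
      intro (G : Set (Ty.Std U σ)) (R : Set (Ty.Std U σ × Ty.Std U τ))
      exact ⟨{P : Set (Ty.Std U σ × Ty.Std U τ) | (∀ p, p ∈ P → p ∈ R) ∧
        (∀ p, p ∈ P → ∃ x, x ∈ G ∧ ∃ y, p = (x, y)) ∧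
        ∀ x, x ∈ G → ∃ y, (x, y) ∈ P ∧ ∀ z, (x, z) ∈ P → z = y},
        fun P => ⟨fun h => h, fun h => h⟩⟩)
  simp only [φ, TypedStr.Holds, TypedStr.eval, TypedStr.cons] at t
  obtain ⟨X, hX⟩ := t G R
  exact ⟨X, fun P => ⟨(hX P).1, (hX P).2⟩⟩

/-- The relation, between members `A` of `G` and hyperreals `y`, that `y` agrees with `μ` if `A` is
in `F`, and that `y` is `ε`-close to the measures of an inner and an outer approximation of `A`. -/
def Approx {τ : Ty} (F : S.Obj (.pow (.pow τ))) (μ : S.Obj (.pow (.prod (.pow τ) .real)))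
    (ε : ℝ) (A : S.Obj (.pow τ)) (y : S.Obj .real) : Prop :=
  S.mem y S.unitInterval ∧ (S.mem A F → S.mem (S.pair A y) μ) ∧
    (∃ C, S.mem C F ∧ (∀ x, S.mem x C → S.mem x A) ∧
      ∃ c, S.mem (S.pair C c) μ ∧ S.Close ε y c) ∧
    ∃ D, S.mem D F ∧ (∀ x, S.mem x A → S.mem x D) ∧
      ∃ d, S.mem (S.pair D d) μ ∧ S.Close ε y d

theorem exists_internal_approx {τ : Ty} (F : S.Obj (.pow (.pow τ)))
    (μ : S.Obj (.pow (.prod (.pow τ) .real))) (ε : ℝ) :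
    ∃ R : S.Obj (.pow (.prod (.pow τ) .real)), ∀ A y,
      S.pair A y ∈ S.ext R ↔ S.Approx F μ ε A y := by
  -- Since `ε` is standard, `ε`-closeness has a name in the language. Closeness for all standard `ε`
  -- at once has none, which is why saturation is needed later.
  let Δ : Ty.Std U (.pow (.prod .real .real)) := closeRel ε
  let I : Ty.Std U (.pow .real) := {x : ULift.{u} ℝ | x.down ∈ Set.Icc (0 : ℝ) 1}
  let φ : Fm U [.real, .pow τ, .pow (.prod (.pow τ) .real), .pow (.prod (.pow τ) .real),
      .pow (.pow τ)] :=
    .and (.mem v0 (.const (τ := .pow .real) I))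
      (.and (.imp (.mem v1 v4) (.mem (.pair v1 v0) v3))
        (.and
          (.ex (.pow τ) (.and (.mem v0 v5) (.and (.all τ (.imp (.mem v0 v1) (.mem v0 v3)))
            (.ex .real (.and (.mem (.pair v1 v0) v5)
              (.mem (.pair v2 v0) (.const (τ := .pow (.prod .real .real)) Δ)))))))
          (.ex (.pow τ) (.and (.mem v0 v5) (.and (.all τ (.imp (.mem v0 v3) (.mem v0 v1)))
            (.ex .real (.and (.mem (.pair v1 v0) v5)
              (.mem (.pair v2 v0) (.const (τ := .pow (.prod .real .real)) Δ)))))))))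
  have t := (S.transfer (.all (.pow (.pow τ)) (.all (.pow (.prod (.pow τ) .real))
    (.ex (.pow (.prod (.pow τ) .real)) (.all (.pow τ) (.all .real
      (.and (.imp (.mem (.pair v1 v0) v2) φ) (.imp φ (.mem (.pair v1 v0) v2))))))))).1 (by
      simp only [φ, TypedStr.Holds, TypedStr.eval, TypedStr.cons]
      intro (F : Set (Set (Ty.Std U τ))) (μ : Set (Set (Ty.Std U τ) × ULift.{u} ℝ))
      exact ⟨{p : Set (Ty.Std U τ) × ULift.{u} ℝ | p.2 ∈ (I : Set (ULift.{u} ℝ)) ∧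
        (p.1 ∈ F → p ∈ μ) ∧
        (∃ C, C ∈ F ∧ (∀ x, x ∈ C → x ∈ p.1) ∧ ∃ c, (C, c) ∈ μ ∧
          (p.2, c) ∈ (Δ : Set (ULift.{u} ℝ × ULift.{u} ℝ))) ∧
        ∃ D, D ∈ F ∧ (∀ x, x ∈ p.1 → x ∈ D) ∧ ∃ d, (D, d) ∈ μ ∧
          (p.2, d) ∈ (Δ : Set (ULift.{u} ℝ × ULift.{u} ℝ))},
        fun A y => ⟨fun h => h, fun h => h⟩⟩)
  simp only [φ, TypedStr.Holds, TypedStr.eval, TypedStr.cons] at t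
  obtain ⟨R, hR⟩ := t F μ
  exact ⟨R, fun A y => ⟨(hR A y).1, (hR A y).2⟩⟩

/-! ### Internal algebras, internal maps, and inner and outer Loeb measure -/

/-- An internal algebra contains the empty set. -/
theorem IsInternalAlgebra.exists_empty {S : NonstandardUniverse.{u, v} U} {τ : Ty}
    {Ω : S.Obj (.pow τ)} {F : S.Obj (.pow (.pow τ))} (hF : S.IsInternalAlgebra Ω F) :
    ∃ E ∈ S.ext F, S.ext E = ∅ := by
  obtain ⟨E, hE, h⟩ := hF.compl_mem Ω hF.space_mem
  exact ⟨E, hE, by rw [h, Set.sdiff_self]⟩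

/-- An internal algebra is closed under differences. -/
theorem IsInternalAlgebra.diff_mem {S : NonstandardUniverse.{u, v} U} {τ : Ty}
    {Ω : S.Obj (.pow τ)} {F : S.Obj (.pow (.pow τ))} (hF : S.IsInternalAlgebra Ω F)
    {A B : S.Obj (.pow τ)} (hA : A ∈ S.ext F) (hB : B ∈ S.ext F) :
    ∃ D ∈ S.ext F, S.ext D = S.ext A \ S.ext B := by
  obtain ⟨A', hA', hA'e⟩ := hF.compl_mem A hA
  obtain ⟨C, hC, hCe⟩ := hF.union_mem A' hA' B hB
  obtain ⟨D, hD, hDe⟩ := hF.compl_mem C hC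
  refine ⟨D, hD, ?_⟩
  rw [hDe, hCe, hA'e]
  have := hF.subset A hA
  grind

variable {S}

theorem IsInternalMap.pair_value_mem {σ : Ty} {G : S.Obj (.pow σ)} {B : S.Obj (.pow .real)}
    {P : S.Obj (.pow (.prod σ .real))} (h : S.IsInternalMap G B P) {A : S.Obj σ}
    (hA : A ∈ S.ext G) : S.pair A (S.value P A) ∈ S.ext P := by
  have hex : ∃ y, S.pair A y ∈ S.ext P := (h.existsUnique A hA).exists
  rw [value, dif_pos hex]
  exact hex.choose_spec

theorem IsInternalMap.value_eq {σ : Ty} {G : S.Obj (.pow σ)} {B : S.Obj (.pow .real)}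
    {P : S.Obj (.pow (.prod σ .real))} (h : S.IsInternalMap G B P) {A : S.Obj σ}
    (hA : A ∈ S.ext G) {y : S.Obj .real} (hy : S.pair A y ∈ S.ext P) : S.value P A = y :=
  (h.existsUnique A hA).unique (h.pair_value_mem hA) hy

theorem IsInternalMap.value_mem {σ : Ty} {G : S.Obj (.pow σ)} {B : S.Obj (.pow .real)}
    {P : S.Obj (.pow (.prod σ .real))} (h : S.IsInternalMap G B P) {A : S.Obj σ}
    (hA : A ∈ S.ext G) : S.value P A ∈ S.ext B := by
  obtain ⟨x, -, y, hy, e⟩ := h.subset_prod _ (h.pair_value_mem hA)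
  rw [(S.pair_injective e).2]
  exact hy

namespace IsAlmostProbability

variable {τ : Ty} {Ω : S.Obj (.pow τ)} {F : S.Obj (.pow (.pow τ))}
  {μ : S.Obj (.pow (.prod (.pow τ) .real))} (hμ : S.IsAlmostProbability Ω F μ)
include hμ

theorem value_mem {A : S.Obj (.pow τ)} (hA : A ∈ S.ext F) :
    S.value μ A ∈ S.ext S.unitInterval := hμ.internal_map.value_mem hA

theorem st_mem {A : S.Obj (.pow τ)} (hA : A ∈ S.ext F) :
    S.st (S.value μ A) ∈ Set.Icc (0 : ℝ) 1 := S.st_mem_Icc (hμ.value_mem hA)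

theorem st_union {A B C : S.Obj (.pow τ)} (hA : A ∈ S.ext F) (hB : B ∈ S.ext F)
    (hC : C ∈ S.ext F) (hd : Disjoint (S.ext A) (S.ext B)) (h : S.ext C = S.ext A ∪ S.ext B) :
    S.st (S.value μ C) = S.st (S.value μ A) + S.st (S.value μ B) :=
  (S.near_add_iff (hμ.value_mem hA) (hμ.value_mem hB) (hμ.value_mem hC)).1
    (hμ.union A hA B hB C hC hd h)

theorem st_mono {A B : S.Obj (.pow τ)} (hA : A ∈ S.ext F) (hB : B ∈ S.ext F)
    (h : S.ext A ⊆ S.ext B) : S.st (S.value μ A) ≤ S.st (S.value μ B) := by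
  obtain ⟨D, hD, hDe⟩ := hμ.algebra.diff_mem hB hA
  have := hμ.st_union hA hD hB (hDe ▸ Set.disjoint_sdiff_right)
    (by rw [hDe, Set.union_sdiff_cancel h])
  linarith [(hμ.st_mem hD).1]

/-- `C` is the disjoint union of `A` and `B \ A`. -/
theorem st_union_le {A B C : S.Obj (.pow τ)} (hA : A ∈ S.ext F) (hB : B ∈ S.ext F)
    (hC : C ∈ S.ext F) (h : S.ext C = S.ext A ∪ S.ext B) :
    S.st (S.value μ C) ≤ S.st (S.value μ A) + S.st (S.value μ B) := by
  obtain ⟨D, hD, hDe⟩ := hμ.algebra.diff_mem hB hA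
  have := hμ.st_union hA hD hC (hDe ▸ Set.disjoint_sdiff_right)
    (by rw [h, hDe, Set.union_sdiff_self])
  linarith [hμ.st_mono hD hB (hDe ▸ Set.sdiff_subset)]

/-- Needed because the supremum and infimum of an empty set of reals default to `0`. -/
theorem inner_nonempty (B : Set (S.Obj τ)) :
    {r : ℝ | ∃ A ∈ S.ext F, S.ext A ⊆ B ∧ r = S.st (S.value μ A)}.Nonempty := by
  obtain ⟨E, hE, he⟩ := hμ.algebra.exists_empty
  exact ⟨_, E, hE, he ▸ Set.empty_subset B, rfl⟩

theorem outer_nonempty {B : Set (S.Obj τ)} (hB : B ⊆ S.ext Ω) :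
    {r : ℝ | ∃ C ∈ S.ext F, B ⊆ S.ext C ∧ r = S.st (S.value μ C)}.Nonempty :=
  ⟨_, Ω, hμ.algebra.space_mem, hB, rfl⟩

theorem le_loebInner {A : S.Obj (.pow τ)} (hA : A ∈ S.ext F) {B : Set (S.Obj τ)}
    (h : S.ext A ⊆ B) : S.st (S.value μ A) ≤ S.loebInner F μ B := by
  refine le_csSup ⟨1, ?_⟩ ⟨A, hA, h, rfl⟩
  rintro r ⟨A, hA, -, rfl⟩
  exact (hμ.st_mem hA).2

theorem loebOuter_le {C : S.Obj (.pow τ)} (hC : C ∈ S.ext F) {B : Set (S.Obj τ)}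
    (h : B ⊆ S.ext C) : S.loebOuter F μ B ≤ S.st (S.value μ C) := by
  refine csInf_le ⟨0, ?_⟩ ⟨C, hC, h, rfl⟩
  rintro r ⟨A, hA, -, rfl⟩
  exact (hμ.st_mem hA).1

theorem exists_lt_of_lt_loebInner {B : Set (S.Obj τ)} {r : ℝ} (h : r < S.loebInner F μ B) :
    ∃ A ∈ S.ext F, S.ext A ⊆ B ∧ r < S.st (S.value μ A) := by
  obtain ⟨_, ⟨A, hA, hAB, rfl⟩, hr⟩ := exists_lt_of_lt_csSup (hμ.inner_nonempty B) h
  exact ⟨A, hA, hAB, hr⟩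

theorem exists_lt_of_loebOuter_lt {B : Set (S.Obj τ)} (hB : B ⊆ S.ext Ω) {r : ℝ}
    (h : S.loebOuter F μ B < r) :
    ∃ C ∈ S.ext F, B ⊆ S.ext C ∧ S.st (S.value μ C) < r := by
  obtain ⟨_, ⟨A, hA, hAB, rfl⟩, hr⟩ := exists_lt_of_csInf_lt (hμ.outer_nonempty hB) h
  exact ⟨A, hA, hAB, hr⟩

theorem loebInner_le_loebOuter {B : Set (S.Obj τ)} (hB : B ⊆ S.ext Ω) :
    S.loebInner F μ B ≤ S.loebOuter F μ B := by
  refine csSup_le (hμ.inner_nonempty B) ?_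
  rintro _ ⟨A, hA, hAB, rfl⟩
  refine le_csInf (hμ.outer_nonempty hB) ?_
  rintro _ ⟨C, hC, hBC, rfl⟩
  exact hμ.st_mono hA hC (hAB.trans hBC)

/-- The members of the algebra belong to the Loeb algebra. -/
theorem ext_mem_loebAlgebra {A : S.Obj (.pow τ)} (hA : A ∈ S.ext F) :
    S.ext A ∈ S.loebAlgebra Ω F μ :=
  ⟨hμ.algebra.subset A hA, le_antisymm (hμ.loebInner_le_loebOuter (hμ.algebra.subset A hA))
    ((hμ.loebOuter_le hA subset_rfl).trans (hμ.le_loebInner hA subset_rfl))⟩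

/-- Members of the Loeb algebra have internal approximations, measured by some hyperreal. -/
theorem exists_approx {ε : ℝ} (hε : 0 < ε) {A : S.Obj (.pow τ)}
    (hA : S.ext A ∈ S.loebAlgebra Ω F μ) : ∃ y, S.Approx F μ ε A y := by
  by_cases hAF : A ∈ S.ext F
  · have hp := hμ.internal_map.pair_value_mem hAF
    have hc : S.Close ε (S.value μ A) (S.value μ A) :=
      S.close_of_abs_lt (hμ.value_mem hAF) (hμ.value_mem hAF) (by simpa using hε)
    exact ⟨S.value μ A, hμ.value_mem hAF, fun _ => hp, ⟨A, hAF, fun _ h => h, _, hp, hc⟩,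
      ⟨A, hAF, fun _ h => h, _, hp, hc⟩⟩
  -- Inner and outer measure agree, so errors of `ε / 2` on each side put `C` and `D` within `ε` of
  -- each other, and `y = μ C` serves for both.
  · obtain ⟨C, hC, hCA, hCr⟩ := hμ.exists_lt_of_lt_loebInner (sub_lt_self _ (half_pos hε))
    obtain ⟨D, hD, hAD, hDr⟩ := hμ.exists_lt_of_loebOuter_lt hA.1
      (lt_add_of_pos_right _ (half_pos hε))
    have heq := hA.2
    have hCD := hμ.st_mono hC hD (hCA.trans hAD)
    refine ⟨S.value μ C, hμ.value_mem hC, fun h => absurd h hAF,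
      ⟨C, hC, hCA, _, hμ.internal_map.pair_value_mem hC, ?_⟩,
      ⟨D, hD, hAD, _, hμ.internal_map.pair_value_mem hD, ?_⟩⟩
    · exact S.close_of_abs_lt (hμ.value_mem hC) (hμ.value_mem hC) (by simpa using hε)
    · refine S.close_of_abs_lt (hμ.value_mem hC) (hμ.value_mem hD) ?_
      rw [abs_lt]
      constructor <;> linarith

end IsAlmostProbability

/-! ### Construction of `P` by saturation -/

theorem Approx.mono {τ : Ty} {F : S.Obj (.pow (.pow τ))}
    {μ : S.Obj (.pow (.prod (.pow τ) .real))} {ε δ : ℝ} (hεδ : ε ≤ δ) {A : S.Obj (.pow τ)}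
    {y : S.Obj .real} (h : S.Approx F μ ε A y) : S.Approx F μ δ A y := by
  obtain ⟨h0, h1, ⟨C, hC, hCA, c, hc, hyc⟩, D, hD, hAD, d, hd, hyd⟩ := h
  exact ⟨h0, h1, ⟨C, hC, hCA, c, hc, hyc.mono hεδ⟩, D, hD, hAD, d, hd, hyd.mono hεδ⟩

/-- By saturation, there is an internal mapping on `G` with values in `*[0,1]` that agrees with `μ`
on `F` and whose values are approximated by `μ` up to infinitesimals. -/
theorem IsAlmostProbability.exists_internal_map {τ : Ty} {Ω : S.Obj (.pow τ)}
    {F G : S.Obj (.pow (.pow τ))} {μ : S.Obj (.pow (.prod (.pow τ) .real))}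
    (hμ : S.IsAlmostProbability Ω F μ)
    (hGF : ∀ A ∈ S.ext G, S.ext A ∈ S.loebAlgebra Ω F μ) :
    ∃ P : S.Obj (.pow (.prod (.pow τ) .real)), S.IsInternalMap G S.unitInterval P ∧
      ∀ A ∈ S.ext G, ∀ ε : ℝ, 0 < ε → S.Approx F μ ε A (S.value P A) := by
  let δ : ℕ → ℝ := fun n => 1 / ((n : ℝ) + 1)
  have hδ : ∀ n, 0 < δ n := fun n => Nat.one_div_pos_of_nat
  choose R hR using fun n => S.exists_internal_approx F μ (δ n)
  choose X hX using fun n => S.exists_internal_selections G (R n)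
  have hne : ∀ n : ℕ, (⋂ i ∈ Finset.range n, S.ext (X i)).Nonempty := by
    intro n
    obtain ⟨P, hPR, hPG, hPf⟩ := S.exists_internal_choice G (R n) fun A hA => by
      obtain ⟨y, hy⟩ := hμ.exists_approx (hδ n) (hGF A hA)
      exact ⟨y, (hR n A y).2 hy⟩
    -- A selection for the tolerance `δ n` also meets the larger tolerances `δ i`, `i < n`.
    refine ⟨P, Set.mem_iInter₂.2 fun i hi => (hX i P).2 ⟨fun p hp => ?_, hPG, hPf⟩⟩
    obtain ⟨A, -, y, rfl⟩ := hPG p hp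
    exact (hR i A y).2 (((hR n A y).1 (hPR _ hp)).mono
      (Nat.one_div_le_one_div (Finset.mem_range.1 hi).le))
  obtain ⟨P, hP⟩ := S.saturation X hne
  have hPX := fun n => (hX n P).1 (Set.mem_iInter.1 hP n)
  have hmap : S.IsInternalMap G S.unitInterval P := by
    -- Domain, range and uniqueness do not involve the tolerance, so the index `0` suffices.
    refine ⟨fun p hp => ?_, fun A hA => (hPX 0).2.2 A hA⟩
    obtain ⟨A, hA, y, rfl⟩ := (hPX 0).2.1 p hp
    exact ⟨A, hA, y, ((hR 0 A y).1 ((hPX 0).1 _ hp)).1, rfl⟩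
  refine ⟨P, hmap, fun A hA ε hε => ?_⟩
  obtain ⟨n, hn⟩ := exists_nat_one_div_lt hε
  exact ((hR n A _).1 ((hPX n).1 _ (hmap.pair_value_mem hA))).mono hn.le

/-- Approximations in terms of standard parts. -/
theorem IsAlmostProbability.exists_of_approx {τ : Ty} {Ω : S.Obj (.pow τ)}
    {F : S.Obj (.pow (.pow τ))} {μ : S.Obj (.pow (.prod (.pow τ) .real))}
    (hμ : S.IsAlmostProbability Ω F μ) {ε : ℝ} {A : S.Obj (.pow τ)} {y : S.Obj .real}
    (h : S.Approx F μ ε A y) :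
    ∃ C ∈ S.ext F, ∃ D ∈ S.ext F, S.ext C ⊆ S.ext A ∧ S.ext A ⊆ S.ext D ∧
      S.st y ≤ S.st (S.value μ C) + ε ∧ S.st (S.value μ D) ≤ S.st y + ε := by
  obtain ⟨h0, -, ⟨C, hC, hCA, c, hc, hyc⟩, D, hD, hAD, d, hd, hyd⟩ := h
  obtain rfl := hμ.internal_map.value_eq hC hc
  obtain rfl := hμ.internal_map.value_eq hD hd
  have h1 := abs_le.1 (S.abs_le_of_close h0 (hμ.value_mem hC) hyc)
  have h2 := abs_le.1 (S.abs_le_of_close h0 (hμ.value_mem hD) hyd)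
  exact ⟨C, hC, D, hD, hCA, hAD, by linarith, by linarith⟩

/-! ### Verification of the measure axioms and of Loeb extension -/

/-- An internal mapping that is approximated by `μ` is an internal almost probability measure. -/
theorem IsAlmostProbability.of_approx {τ : Ty} {Ω : S.Obj (.pow τ)}
    {F G : S.Obj (.pow (.pow τ))} {μ P : S.Obj (.pow (.prod (.pow τ) .real))}
    (hμ : S.IsAlmostProbability Ω F μ) (hG : S.IsInternalAlgebra Ω G)
    (hP : S.IsInternalMap G S.unitInterval P)
    (h : ∀ A ∈ S.ext G, ∀ ε : ℝ, 0 < ε → S.Approx F μ ε A (S.value P A)) :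
    S.IsAlmostProbability Ω G P := by
  -- The values at `∅` and `Ω` must be exact, and closeness gives them only up to infinitesimals;
  -- hence the clause of `Approx` about members of `F`. The tolerance `1` is arbitrary.
  have agree : ∀ A ∈ S.ext G, A ∈ S.ext F → S.value P A = S.value μ A := fun A hA hAF =>
    (hμ.internal_map.value_eq hAF ((h A hA 1 one_pos).2.1 hAF)).symm
  refine ⟨hG, hP, fun A hA hAe => ?_, ?_, fun A hA B hB C hC hd hu => ?_⟩
  · obtain ⟨E, hE, he⟩ := hμ.algebra.exists_empty
    obtain rfl : A = E := S.ext_injective (hAe.trans he.symm)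
    rw [agree A hA hE, hμ.empty A hE hAe]
  · rw [agree Ω hG.space_mem hμ.algebra.space_mem, hμ.space]
  · rw [S.near_add_iff (hP.value_mem hA) (hP.value_mem hB) (hP.value_mem hC)]
    -- One `ε` is lost for each of `A`, `B`, `C`. The inner sets of `A` and `B` are disjoint, so `μ`
    -- adds on them; the outer sets may overlap, where subadditivity is enough.
    have key : ∀ ε : ℝ, 0 < ε →
        S.st (S.value P C) ≤ S.st (S.value P A) + S.st (S.value P B) + 3 * ε ∧
        S.st (S.value P A) + S.st (S.value P B) ≤ S.st (S.value P C) + 3 * ε := by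
      intro ε hε
      obtain ⟨A₁, hA₁, A₂, hA₂, hA₁A, hAA₂, hA3, hA4⟩ := hμ.exists_of_approx (h A hA ε hε)
      obtain ⟨B₁, hB₁, B₂, hB₂, hB₁B, hBB₂, hB3, hB4⟩ := hμ.exists_of_approx (h B hB ε hε)
      obtain ⟨C₁, hC₁, C₂, hC₂, hC₁C, hCC₂, hC3, hC4⟩ := hμ.exists_of_approx (h C hC ε hε)
      obtain ⟨V, hV, hVe⟩ := hμ.algebra.union_mem A₁ hA₁ B₁ hB₁
      obtain ⟨W, hW, hWe⟩ := hμ.algebra.union_mem A₂ hA₂ B₂ hB₂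
      have h1 := hμ.st_union hA₁ hB₁ hV (hd.mono hA₁A hB₁B) hVe
      have h2 := hμ.st_union_le hA₂ hB₂ hW hWe
      have h3 := hμ.st_mono hV hC₂
        (by rw [hVe]; exact (Set.union_subset_union hA₁A hB₁B).trans (hu ▸ hCC₂))
      have h4 := hμ.st_mono hC₁ hW
        (by rw [hWe]; exact hC₁C.trans (hu ▸ Set.union_subset_union hAA₂ hBB₂))
      constructor <;> linarith
    refine le_antisymm (le_of_forall_pos_le_add fun ε hε => ?_)
      (le_of_forall_pos_le_add fun ε hε => ?_)
    · have := (key (ε / 3) (by positivity)).1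
      linarith
    · have := (key (ε / 3) (by positivity)).2
      linarith

/-- A space Loeb extends every space whose measure it approximates. -/
theorem IsAlmostProbability.loebExtends_of_approx {τ : Ty} {Ω : S.Obj (.pow τ)}
    {F G : S.Obj (.pow (.pow τ))} {μ P : S.Obj (.pow (.prod (.pow τ) .real))}
    (hμ : S.IsAlmostProbability Ω F μ) (hP : S.IsAlmostProbability Ω G P)
    (h : ∀ A ∈ S.ext G, ∀ ε : ℝ, 0 < ε → S.Approx F μ ε A (S.value P A)) :
    S.LoebExtends Ω F μ G P := by
  -- With inner at most outer for `μ`, this gives the chain inner `P` ≤ inner `μ` ≤ outer `μ` ≤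
  -- outer `P`, whose ends coincide on the Loeb algebra of `P`.
  have key : ∀ B ∈ S.loebAlgebra Ω G P,
      S.loebInner G P B ≤ S.loebInner F μ B ∧ S.loebOuter F μ B ≤ S.loebOuter G P B := by
    intro B hB
    refine ⟨le_of_forall_pos_le_add fun ε hε => ?_, le_of_forall_pos_le_add fun ε hε => ?_⟩
    · obtain ⟨A, hA, hAB, hr⟩ := hP.exists_lt_of_lt_loebInner
        (sub_lt_self (S.loebInner G P B) (half_pos hε))
      obtain ⟨C, hC, -, -, hCA, -, hle, -⟩ := hμ.exists_of_approx (h A hA _ (half_pos hε))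
      linarith [hμ.le_loebInner hC (hCA.trans hAB)]
    · obtain ⟨A, hA, hBA, hr⟩ := hP.exists_lt_of_loebOuter_lt hB.1
        (lt_add_of_pos_right _ (half_pos hε))
      obtain ⟨-, -, D, hD, -, hAD, -, hle⟩ := hμ.exists_of_approx (h A hA _ (half_pos hε))
      linarith [hμ.loebOuter_le hD (hBA.trans hAD)]
  constructor
  · intro B hB
    have hk := key B hB
    have := hμ.loebInner_le_loebOuter hB.1
    have := hB.2
    exact ⟨hB.1, by linarith⟩
  · intro B hB
    have hk := key B hB
    have := hμ.loebInner_le_loebOuter hB.1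
    have := hB.2
    exact le_antisymm (by rw [loebMeasure, loebMeasure]; linarith) hk.1

end NonstandardUniverse

theorem theorem3p4 {U : Type u} (S : NonstandardUniverse.{u, v} U) {τ : Ty}
    (Ω : S.Obj (.pow τ)) (F G : S.Obj (.pow (.pow τ)))
    (μ : S.Obj (.pow (.prod (.pow τ) .real)))
    (hμ : S.IsAlmostProbability Ω F μ) (hG : S.IsInternalAlgebra Ω G) :
    (∃ P : S.Obj (.pow (.prod (.pow τ) .real)),
        S.IsAlmostProbability Ω G P ∧ S.LoebExtends Ω F μ G P) ↔
      ∀ A ∈ S.ext G, S.ext A ∈ S.loebAlgebra Ω F μ := by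
  constructor
  · rintro ⟨P, hP, hext⟩ A hA
    exact hext.1 (hP.ext_mem_loebAlgebra hA)
  · intro h
    obtain ⟨P, hPm, hP⟩ := hμ.exists_internal_map h
    have hP' := hμ.of_approx hG hPm hP
    exact ⟨P, hP', hμ.loebExtends_of_approx hP' hP⟩
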